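/- Work in the infinitary logic $L_{\omega_1\omega}$ (countable conjunctions and disjunctions) with equality, over the language $\{\le\}$ of linear orders; structures may be empty. A $\Sigma_1$ (respectively $\Pi_1$) formula is a countable disjunction of formulas $\exists\bar y\,\psi$ (respectively a countable conjunction of formulas $\forall\bar y\,\psi$) with $\psi$ finitary and quantifier-free. For countable ordinals $\alpha\ge 1$ define classes of formulas $E_\alpha, A_\alpha,\overline{E}_\alpha,\overline{A}_\alpha$ by simultaneous recursion: - $E_1=\Sigma_1$ and $A_1=\Pi_1$; - for $\alpha>1$, $E_\alpha$ is the closure of $\bigcup_{1\le\beta<\alpha}\overline{A}_\beta$ under $\exists$ and countable disjunctions, and $A_\alpha$ is the closure of $\bigcup_{1\le\beta<\alpha}\overline{E}_\beta$ under $\forall$ and countable conjunctions; - $\overline{E}_\alpha$ and $\overline{A}_\alpha$ are the closures of $E_\alpha$ and $A_\alpha$, respectively, under countable disjunctions and countable conjunctions. For elements $a_1<\cdots<a_n$ of a linear order put $a_0=-\infty$ and $a_{n+1}=\infty$, and regard each open interval $(a_k,a_{k+1})$, $0\le k\le n$, as a linear order in its own right. **Lemma.** Let $1\le\alpha<\omega_1$,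 let $\mathcal L$ be a countable linear order, let $a_1<\cdots<a_n$ be elements of $\mathcal L$, and let $\varphi(x_1,\dots,x_n)$ be an $E_\alpha$ formula with $\mathcal L\models\varphi(a_1,\dots,a_n)$. Then there are $E_\alpha$ sentences $\theta_0,\dots,\theta_n$ such that (a) $(a_k,a_{k+1})\models\theta_k$ for every $k=0,\dots,n$; and (b) for every linear order $\mathcal B$ (of any cardinality) and all elements $b_1<\cdots<b_n$ of $\mathcal B$ (with $b_0=-\infty$, $b_{n+1}=\infty$), if $(b_k,b_{k+1})\models\theta_k$ for every $k=0,\dots,n$, then $\mathcal B\models\varphi(b_1,\dots,b_n)$. -/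

import Mathlib

universe u v

/-- Formulas of the infinitary logic `L_{ω₁ω}` over the first-order language `L` whose free
variables are among `x₀, …, x_{n-1}`: atomic formulas, negation, conjunctions and disjunctions over
countable (possibly finite or empty) index sets, and quantification over the last variable. -/
inductive InfFormula (L : FirstOrder.Language.{0, 0}) : ℕ → Type 1
  | equal {n : ℕ} (s t : L.Term (Fin n)) : InfFormula L n
  | rel {n k : ℕ} (R : L.Relations k) (ts : Fin k → L.Term (Fin n)) : InfFormula L n
  | neg {n : ℕ} (φ : InfFormula L n) : InfFormula L n
  | conj {n : ℕ} (ι : Type) (hι : Countable ι) (φ : ι → InfFormula L n) : InfFormula L n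
  | disj {n : ℕ} (ι : Type) (hι : Countable ι) (φ : ι → InfFormula L n) : InfFormula L n
  | all {n : ℕ} (φ : InfFormula L (n + 1)) : InfFormula L n
  | ex {n : ℕ} (φ : InfFormula L (n + 1)) : InfFormula L n

/-- Sentences of `L_{ω₁ω}`: formulas without free variables. -/
abbrev InfSentence (L : FirstOrder.Language.{0, 0}) : Type 1 := InfFormula L 0

namespace InfFormula

variable {L : FirstOrder.Language.{0, 0}}

/-- Satisfaction of a formula in a (possibly empty) structure. -/
def Realize {M : Type u} [L.Structure M] :
    {n : ℕ} → InfFormula L n → (Fin n → M) → Prop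
  | _, equal s t, a => s.realize a = t.realize a
  | _, rel R ts, a => FirstOrder.Language.Structure.RelMap R (fun i => (ts i).realize a)
  | _, neg φ, a => ¬ φ.Realize a
  | _, conj ι _ φ, a => ∀ i : ι, (φ i).Realize a
  | _, disj ι _ φ, a => ∃ i : ι, (φ i).Realize a
  | _, all φ, a => ∀ y : M, φ.Realize (Fin.snoc a y : Fin (_ + 1) → M)
  | _, ex φ, a => ∃ y : M, φ.Realize (Fin.snoc a y : Fin (_ + 1) → M)

/-- The block of quantifiers `∃ x_n … x_{n+k-1}`. -/
def exs {n : ℕ} : (k : ℕ) → InfFormula L (n + k) → InfFormula L n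
  | 0, φ => φ
  | k + 1, φ => exs k (ex φ)

/-- The block of quantifiers `∀ x_n … x_{n+k-1}`. -/
def alls {n : ℕ} : (k : ℕ) → InfFormula L (n + k) → InfFormula L n
  | 0, φ => φ
  | k + 1, φ => alls k (all φ)

/-- Finitary quantifier-free formulas. -/
inductive IsFinitaryQF : {n : ℕ} → InfFormula L n → Prop
  | equal {n : ℕ} (s t : L.Term (Fin n)) : IsFinitaryQF (equal s t)
  | rel {n k : ℕ} (R : L.Relations k) (ts : Fin k → L.Term (Fin n)) : IsFinitaryQF (rel R ts)
  | neg {n : ℕ} {φ : InfFormula L n} : IsFinitaryQF φ → IsFinitaryQF (neg φ)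
  | conj {n : ℕ} {ι : Type} {hι : Countable ι} {φ : ι → InfFormula L n} :
      Finite ι → (∀ i, IsFinitaryQF (φ i)) → IsFinitaryQF (conj ι hι φ)
  | disj {n : ℕ} {ι : Type} {hι : Countable ι} {φ : ι → InfFormula L n} :
      Finite ι → (∀ i, IsFinitaryQF (φ i)) → IsFinitaryQF (disj ι hι φ)

/-- `Σ₁` formulas: countable disjunctions of formulas `∃ ȳ ψ` with `ψ` finitary quantifier-free. -/
def IsSigmaOne {n : ℕ} (φ : InfFormula L n) : Prop :=
  ∃ (ι : Type) (hι : Countable ι) (k : ι → ℕ) (ψ : (i : ι) → InfFormula L (n + k i)),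
    (∀ i, IsFinitaryQF (ψ i)) ∧ φ = disj ι hι (fun i => exs (k i) (ψ i))

/-- `Π₁` formulas: countable conjunctions of formulas `∀ ȳ ψ` with `ψ` finitary quantifier-free. -/
def IsPiOne {n : ℕ} (φ : InfFormula L n) : Prop :=
  ∃ (ι : Type) (hι : Countable ι) (k : ι → ℕ) (ψ : (i : ι) → InfFormula L (n + k i)),
    (∀ i, IsFinitaryQF (ψ i)) ∧ φ = conj ι hι (fun i => alls (k i) (ψ i))

/-- Names for the four families of formula classes `E_α`, `A_α`, `Ē_α`, `Ā_α`. -/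
inductive EAKind
  | E
  | A
  | Ebar
  | Abar

/-- The classes `E_α`, `A_α`, `Ē_α`, `Ā_α` for ordinals `α ≥ 1`, by simultaneous recursion:
* `E_1 = Σ₁` and `A_1 = Π₁`;
* for `α > 1`, `E_α` is the closure of `⋃_{1 ≤ β < α} Ā_β` under `∃` and countable disjunctions,
  and `A_α` is the closure of `⋃_{1 ≤ β < α} Ē_β` under `∀` and countable conjunctions;
* `Ē_α` and `Ā_α` are the closures of `E_α` and `A_α` under countable disjunctions and
  conjunctions. -/
inductive InClass : EAKind → Ordinal.{0} → {n : ℕ} → InfFormula L n → Prop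
  | E_one {n : ℕ} {φ : InfFormula L n} : IsSigmaOne φ → InClass .E 1 φ
  | A_one {n : ℕ} {φ : InfFormula L n} : IsPiOne φ → InClass .A 1 φ
  | E_base {α β : Ordinal.{0}} {n : ℕ} {φ : InfFormula L n} :
      1 ≤ β → β < α → InClass .Abar β φ → InClass .E α φ
  | E_ex {α : Ordinal.{0}} {n : ℕ} {φ : InfFormula L (n + 1)} :
      1 < α → InClass .E α φ → InClass .E α (ex φ)
  | E_disj {α : Ordinal.{0}} {n : ℕ} {ι : Type} {hι : Countable ι} {φ : ι → InfFormula L n} :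
      1 < α → (∀ i, InClass .E α (φ i)) → InClass .E α (disj ι hι φ)
  | A_base {α β : Ordinal.{0}} {n : ℕ} {φ : InfFormula L n} :
      1 ≤ β → β < α → InClass .Ebar β φ → InClass .A α φ
  | A_all {α : Ordinal.{0}} {n : ℕ} {φ : InfFormula L (n + 1)} :
      1 < α → InClass .A α φ → InClass .A α (all φ)
  | A_conj {α : Ordinal.{0}} {n : ℕ} {ι : Type} {hι : Countable ι} {φ : ι → InfFormula L n} :
      1 < α → (∀ i, InClass .A α (φ i)) → InClass .A α (conj ι hι φ)
  | Ebar_base {α : Ordinal.{0}} {n : ℕ} {φ : InfFormula L n} :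
      InClass .E α φ → InClass .Ebar α φ
  | Ebar_disj {α : Ordinal.{0}} {n : ℕ} {ι : Type} {hι : Countable ι} {φ : ι → InfFormula L n} :
      (∀ i, InClass .Ebar α (φ i)) → InClass .Ebar α (disj ι hι φ)
  | Ebar_conj {α : Ordinal.{0}} {n : ℕ} {ι : Type} {hι : Countable ι} {φ : ι → InfFormula L n} :
      (∀ i, InClass .Ebar α (φ i)) → InClass .Ebar α (conj ι hι φ)
  | Abar_base {α : Ordinal.{0}} {n : ℕ} {φ : InfFormula L n} :
      InClass .A α φ → InClass .Abar α φ
  | Abar_disj {α : Ordinal.{0}} {n : ℕ} {ι : Type} {hι : Countable ι} {φ : ι → InfFormula L n} :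
      (∀ i, InClass .Abar α (φ i)) → InClass .Abar α (disj ι hι φ)
  | Abar_conj {α : Ordinal.{0}} {n : ℕ} {ι : Type} {hι : Countable ι} {φ : ι → InfFormula L n} :
      (∀ i, InClass .Abar α (φ i)) → InClass .Abar α (conj ι hι φ)

/-- `E_α` formulas. -/
abbrev IsE (α : Ordinal.{0}) {n : ℕ} (φ : InfFormula L n) : Prop := InClass .E α φ

end InfFormula

/-- Truth of a sentence in a structure. -/
def InfSentence.Holds (M : Type u) {L : FirstOrder.Language.{0, 0}} [L.Structure M] (θ : InfSentence L) :
    Prop :=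
  InfFormula.Realize θ (Fin.elim0 : Fin 0 → M)

/-- Every linear order is a structure in the language with equality and one binary relation `≤`. -/
@[reducible]
instance linearOrderStructure (M : Type u) [LinearOrder M] :
    FirstOrder.Language.order.Structure M :=
  FirstOrder.Language.orderStructure M

/-- With `a₁ < ⋯ < a_n` enumerated as `a 0 < ⋯ < a (n - 1)`, and the convention `a₀ = -∞`,
`a_{n+1} = ∞`, this is the open interval `(a_k, a_{k+1})` for `k = 0, …, n`: the lower bound is
`a (k - 1)` (absent for `k = 0`), the upper bound is `a k` (absent for `k = n`). -/
def cutInterval {M : Type u} [LinearOrder M] {n : ℕ} (a : Fin n → M) (k : Fin (n + 1)) : Set M :=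
  {x | (∀ i : Fin n, (i : ℕ) + 1 = (k : ℕ) → a i < x) ∧ (∀ i : Fin n, (i : ℕ) = (k : ℕ) → x < a i)}

/-! The proof links the class E_α with asymmetric back-and-forth relations. The truth of an E_α
formula at a tuple of `𝓛` is certified by bounded data: some γ < α and a finite D ⊆ 𝓛 such that the
formula transfers along every relation Q with D in its domain and `BackForth γ true Q`
(`InClass.preserved`). The certificate does not mention the target order.

Conversely, over a countable order an E_α sentence can assert that a given finite set has such a
counterpart (`exists_E_sentence`); this rests on Scott-type A_β formulas describing the β-th type of
a tuple (`exists_A_captures`).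

Finally, relations of level γ between corresponding open intervals glue to one of level γ between
the whole orders (`BackForth.glue`). So θ_k says that the part of D inside the k-th interval has a
γ-counterpart, and if all θ_k hold in the intervals of `B`, the glued relation carries φ over. -/

open FirstOrder

/-! ### Back-and-forth relations. -/

/-- A binary relation between linear orders that preserves and reflects `≤`; it is then the graph
of a partial isomorphism. -/
def IsPartialIso {A : Type u} {B : Type v} [LinearOrder A] [LinearOrder B] (P : Set (A × B)) :
    Prop :=
  ∀ p ∈ P, ∀ q ∈ P, p.1 ≤ q.1 ↔ p.2 ≤ q.2

/-- The asymmetric back-and-forth relations. `BackForth β true P` says that `(A, dom P) ≤_β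
(B, ran P)`, and `BackForth β false P` that `(B, ran P) ≤_β (A, dom P)`. -/
def BackForth {A : Type u} {B : Type v} [LinearOrder A] [LinearOrder B] :
    Ordinal.{0} → Bool → Set (A × B) → Prop
  | β, true, P => IsPartialIso P ∧ ∀ γ, γ < β → ∀ D : Set B, D.Finite →
      ∃ Q, P ⊆ Q ∧ D ⊆ Prod.snd '' Q ∧ BackForth γ false Q
  | β, false, P => IsPartialIso P ∧ ∀ γ, γ < β → ∀ D : Set A, D.Finite →
      ∃ Q, P ⊆ Q ∧ D ⊆ Prod.fst '' Q ∧ BackForth γ true Q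
termination_by β => β

namespace BackForth

variable {A : Type u} {B : Type v} [LinearOrder A] [LinearOrder B]
  {β γ : Ordinal.{0}} {dir : Bool} {P Q : Set (A × B)}

theorem true_iff : BackForth β true P ↔ IsPartialIso P ∧ ∀ γ, γ < β → ∀ D : Set B, D.Finite →
    ∃ Q, P ⊆ Q ∧ D ⊆ Prod.snd '' Q ∧ BackForth γ false Q := by
  rw [BackForth]

theorem false_iff : BackForth β false P ↔ IsPartialIso P ∧ ∀ γ, γ < β → ∀ D : Set A, D.Finite →
    ∃ Q, P ⊆ Q ∧ D ⊆ Prod.fst '' Q ∧ BackForth γ true Q := by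
  rw [BackForth]

theorem isPartialIso (h : BackForth β dir P) : IsPartialIso P := by
  cases dir
  · exact (false_iff.1 h).1
  · exact (true_iff.1 h).1

theorem zero_iff : BackForth 0 dir P ↔ IsPartialIso P := by
  cases dir
  · simp [false_iff]
  · simp [true_iff]

theorem mono (hPQ : P ⊆ Q) (hγβ : γ ≤ β) (h : BackForth β dir Q) : BackForth γ dir P := by
  have hiso : IsPartialIso P := fun p hp q hq => h.isPartialIso p (hPQ hp) q (hPQ hq)
  cases dir
  · refine false_iff.2 ⟨hiso, fun δ hδ D hD => ?_⟩
    obtain ⟨R, hR, h'⟩ := (false_iff.1 h).2 δ (hδ.trans_le hγβ) D hD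
    exact ⟨R, hPQ.trans hR, h'⟩
  · refine true_iff.2 ⟨hiso, fun δ hδ D hD => ?_⟩
    obtain ⟨R, hR, h'⟩ := (true_iff.1 h).2 δ (hδ.trans_le hγβ) D hD
    exact ⟨R, hPQ.trans hR, h'⟩

/-- The condition needs to be checked only for `γ` in a final segment. -/
theorem true_of_forall_ge {γ₀ : Ordinal.{0}} (hγ₀ : γ₀ < β)
    (h : ∀ γ, γ₀ ≤ γ → γ < β → ∀ D : Set B, D.Finite →
      ∃ Q, P ⊆ Q ∧ D ⊆ Prod.snd '' Q ∧ BackForth γ false Q) : BackForth β true P := by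
  refine true_iff.2 ⟨?_, fun γ hγ D hD => ?_⟩
  -- Taking D empty already yields a partial isomorphism containing P.
  · obtain ⟨Q, hQ, -, h'⟩ := h γ₀ le_rfl hγ₀ ∅ Set.finite_empty
    exact (h'.mono hQ le_rfl).isPartialIso
  · obtain ⟨Q, hQ, hD, h'⟩ := h (max γ γ₀) (le_max_right _ _) (max_lt hγ hγ₀) D hD
    exact ⟨Q, hQ, hD, h'.mono subset_rfl (le_max_left _ _)⟩

theorem false_of_forall_ge {γ₀ : Ordinal.{0}} (hγ₀ : γ₀ < β)
    (h : ∀ γ, γ₀ ≤ γ → γ < β → ∀ D : Set A, D.Finite →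
      ∃ Q, P ⊆ Q ∧ D ⊆ Prod.fst '' Q ∧ BackForth γ true Q) : BackForth β false P := by
  refine false_iff.2 ⟨?_, fun γ hγ D hD => ?_⟩
  · obtain ⟨Q, hQ, -, h'⟩ := h γ₀ le_rfl hγ₀ ∅ Set.finite_empty
    exact (h'.mono hQ le_rfl).isPartialIso
  · obtain ⟨Q, hQ, hD, h'⟩ := h (max γ γ₀) (le_max_right _ _) (max_lt hγ hγ₀) D hD
    exact ⟨Q, hQ, hD, h'.mono subset_rfl (le_max_left _ _)⟩

end BackForth

/-! ### Preservation of formulas along back-and-forth relations. -/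

namespace InfFormula

/-- The language has no function symbols, so every term is a variable. -/
theorem exists_realize_term_eq {M : Type u} [LinearOrder M] {N : Type v} [LinearOrder N] {n : ℕ}
    (t : Language.order.Term (Fin n)) :
    ∃ i, (∀ x : Fin n → M, t.realize x = x i) ∧ (∀ y : Fin n → N, t.realize y = y i) := by
  cases t with
  | var i => exact ⟨i, fun _ => rfl, fun _ => rfl⟩
  | func f _ => exact f.elim

theorem IsFinitaryQF.realize_iff {A : Type u} {B : Type v} [LinearOrder A] [LinearOrder B]
    {P : Set (A × B)} (hP : IsPartialIso P) {n : ℕ} {φ : InfFormula Language.order n}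
    (hφ : IsFinitaryQF φ) {x : Fin n → A} {y : Fin n → B} (hxy : ∀ i, (x i, y i) ∈ P) :
    φ.Realize x ↔ φ.Realize y := by
  induction hφ with
  | equal s t =>
    obtain ⟨i, hi, hi'⟩ := exists_realize_term_eq (M := A) (N := B) s
    obtain ⟨j, hj, hj'⟩ := exists_realize_term_eq (M := A) (N := B) t
    have h₁ := hP _ (hxy i) _ (hxy j)
    have h₂ := hP _ (hxy j) _ (hxy i)
    simp only [Realize, hi, hi', hj, hj', le_antisymm_iff]
    exact and_congr h₁ h₂
  | rel R ts =>
    cases R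
    obtain ⟨i, hi, hi'⟩ := exists_realize_term_eq (M := A) (N := B) (ts 0)
    obtain ⟨j, hj, hj'⟩ := exists_realize_term_eq (M := A) (N := B) (ts 1)
    change (ts 0).realize x ≤ (ts 1).realize x ↔ (ts 0).realize y ≤ (ts 1).realize y
    rw [hi, hi', hj, hj']
    exact hP _ (hxy i) _ (hxy j)
  | neg _ ih => exact not_congr ih
  | conj _ _ ih => exact forall_congr' fun i => ih i
  | disj _ _ ih => exact exists_congr fun i => ih i

/-- How the formulas of each class are preserved by back-and-forth relations. -/
def Preserved : EAKind → Ordinal.{0} → {n : ℕ} → InfFormula Language.order n → Prop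
  | .E, α, n, φ => ∀ (A : Type u) [LinearOrder A] (x : Fin n → A), φ.Realize x →
      ∃ γ < α, ∃ D : Set A, D.Finite ∧ ∀ (B : Type v) [LinearOrder B] (Q : Set (A × B)),
        D ⊆ Prod.fst '' Q → BackForth γ true Q →
        ∀ y : Fin n → B, (∀ i, (x i, y i) ∈ Q) → φ.Realize y
  | .A, α, n, φ => ∀ (B : Type v) [LinearOrder B] (y : Fin n → B), ¬ φ.Realize y →
      ∃ γ < α, ∃ D : Set B, D.Finite ∧ ∀ (A : Type u) [LinearOrder A] (Q : Set (A × B)),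
        D ⊆ Prod.snd '' Q → BackForth γ false Q →
        ∀ x : Fin n → A, (∀ i, (x i, y i) ∈ Q) → ¬ φ.Realize x
  | .Ebar, α, n, φ => ∀ (A : Type u) [LinearOrder A] (B : Type v) [LinearOrder B]
      (Q : Set (A × B)), BackForth α false Q →
      ∀ (x : Fin n → A) (y : Fin n → B), (∀ i, (x i, y i) ∈ Q) → φ.Realize x → φ.Realize y
  | .Abar, α, n, φ => ∀ (A : Type u) [LinearOrder A] (B : Type v) [LinearOrder B]
      (Q : Set (A × B)), BackForth α true Q →
      ∀ (x : Fin n → A) (y : Fin n → B), (∀ i, (x i, y i) ∈ Q) → φ.Realize x → φ.Realize y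

theorem snoc_mem {A : Type u} {B : Type v} {P : Set (A × B)} {n : ℕ} {x : Fin n → A}
    {y : Fin n → B} (h : ∀ i, (x i, y i) ∈ P) {a : A} {b : B} (hab : (a, b) ∈ P)
    (i : Fin (n + 1)) :
    ((Fin.snoc x a : Fin (n + 1) → A) i, (Fin.snoc y b : Fin (n + 1) → B) i) ∈ P := by
  induction i using Fin.lastCases with
  | last => simpa using hab
  | cast i => simpa using h i

theorem Preserved.ex {α : Ordinal.{0}} {n : ℕ} {φ : InfFormula Language.order (n + 1)}
    (h : Preserved.{u, v} .E α φ) : Preserved.{u, v} .E α (ex φ) := by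
  rintro A _ x ⟨a, ha⟩
  obtain ⟨γ, hγ, D, hD, h'⟩ := h A _ ha
  refine ⟨γ, hγ, insert a D, hD.insert a, fun B _ Q hDQ hQ y hxy => ?_⟩
  obtain ⟨⟨_, b⟩, hab, rfl⟩ := hDQ (Set.mem_insert a D)
  exact ⟨b, h' B Q ((Set.subset_insert _ _).trans hDQ) hQ _ (snoc_mem hxy hab)⟩

theorem Preserved.all {α : Ordinal.{0}} {n : ℕ} {φ : InfFormula Language.order (n + 1)}
    (h : Preserved.{u, v} .A α φ) : Preserved.{u, v} .A α (all φ) := by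
  intro B _ y hy
  obtain ⟨b, hb⟩ := not_forall.1 hy
  obtain ⟨γ, hγ, D, hD, h'⟩ := h B _ hb
  refine ⟨γ, hγ, insert b D, hD.insert b, fun A _ Q hDQ hQ x hxy hx => ?_⟩
  obtain ⟨⟨a, _⟩, hab, rfl⟩ := hDQ (Set.mem_insert b D)
  exact h' A Q ((Set.subset_insert _ _).trans hDQ) hQ _ (snoc_mem hxy hab) (hx a)

theorem Preserved.exs {α : Ordinal.{0}} {n : ℕ} : ∀ (k : ℕ)
    {φ : InfFormula Language.order (n + k)}, Preserved.{u, v} .E α φ →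
      Preserved.{u, v} .E α (exs k φ)
  | 0, _, h => h
  | k + 1, _, h => Preserved.exs k h.ex

theorem Preserved.alls {α : Ordinal.{0}} {n : ℕ} : ∀ (k : ℕ)
    {φ : InfFormula Language.order (n + k)}, Preserved.{u, v} .A α φ →
      Preserved.{u, v} .A α (alls k φ)
  | 0, _, h => h
  | k + 1, _, h => Preserved.alls k h.all

theorem Preserved.disj {α : Ordinal.{0}} {n : ℕ} {ι : Type} {hι : Countable ι}
    {φ : ι → InfFormula Language.order n} (h : ∀ i, Preserved.{u, v} .E α (φ i)) :
    Preserved.{u, v} .E α (disj ι hι φ) := by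
  rintro A _ x ⟨i, hi⟩
  obtain ⟨γ, hγ, D, hD, h'⟩ := h i A x hi
  exact ⟨γ, hγ, D, hD, fun B _ Q hDQ hQ y hxy => ⟨i, h' B Q hDQ hQ y hxy⟩⟩

theorem Preserved.conj {α : Ordinal.{0}} {n : ℕ} {ι : Type} {hι : Countable ι}
    {φ : ι → InfFormula Language.order n} (h : ∀ i, Preserved.{u, v} .A α (φ i)) :
    Preserved.{u, v} .A α (conj ι hι φ) := by
  intro B _ y hy
  obtain ⟨i, hi⟩ := not_forall.1 hy
  obtain ⟨γ, hγ, D, hD, h'⟩ := h i B y hi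
  exact ⟨γ, hγ, D, hD, fun A _ Q hDQ hQ x hxy hx => h' A Q hDQ hQ x hxy (hx i)⟩

theorem IsFinitaryQF.preserved_E {n : ℕ} {φ : InfFormula Language.order n} (h : IsFinitaryQF φ) :
    Preserved.{u, v} .E 1 φ := fun _ _ _ hx =>
  ⟨0, zero_lt_one, ∅, Set.finite_empty, fun _ _ _ _ hQ _ hxy =>
    (h.realize_iff hQ.isPartialIso hxy).1 hx⟩

theorem IsFinitaryQF.preserved_A {n : ℕ} {φ : InfFormula Language.order n} (h : IsFinitaryQF φ) :
    Preserved.{u, v} .A 1 φ := fun _ _ _ hy =>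
  ⟨0, zero_lt_one, ∅, Set.finite_empty, fun _ _ _ _ hQ _ hxy hx =>
    hy ((h.realize_iff hQ.isPartialIso hxy).1 hx)⟩

/-- For E, the data γ and D survive ∃ (add the witness to D) and disjunctions (pick a true
disjunct). An infinite conjunction could require infinitely many such choices, so the barred classes
get only transfer at the full level α, where any γ < α and finite D are available. A is dual, with
certificates of falsity. -/
theorem InClass.preserved {K : EAKind} {α : Ordinal.{0}} {n : ℕ}
    {φ : InfFormula Language.order n} (h : InClass K α φ) : Preserved.{u, v} K α φ := by
  induction h with
  | E_one h =>
    obtain ⟨ι, hι, k, ψ, hψ, rfl⟩ := h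
    exact .disj fun i => .exs _ (hψ i).preserved_E
  | A_one h =>
    obtain ⟨ι, hι, k, ψ, hψ, rfl⟩ := h
    exact .conj fun i => .alls _ (hψ i).preserved_A
  | @E_base α β n φ _ hβ _ ih =>
    -- An Ā_β formula transfers outright at level β, so no extra points are needed.
    exact fun A _ x hx => ⟨β, hβ, ∅, Set.finite_empty, fun B _ Q _ hQ y hxy =>
      ih A B Q hQ x y hxy hx⟩
  | E_ex _ _ ih => exact ih.ex
  | E_disj _ _ ih => exact .disj ih
  | @A_base α β n φ _ hβ _ ih =>
    exact fun B _ y hy => ⟨β, hβ, ∅, Set.finite_empty, fun A _ Q _ hQ x hxy hx =>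
      hy (ih A B Q hQ x y hxy hx)⟩
  | A_all _ _ ih => exact ih.all
  | A_conj _ _ ih => exact .conj ih
  | Ebar_base _ ih =>
    intro A _ B _ P hP x y hxy hx
    obtain ⟨γ, hγ, D, hD, h'⟩ := ih A x hx
    obtain ⟨Q, hPQ, hDQ, hQ⟩ := (BackForth.false_iff.1 hP).2 γ hγ D hD
    exact h' B Q hDQ hQ y fun i => hPQ (hxy i)
  | Ebar_disj _ ih =>
    rintro A _ B _ P hP x y hxy ⟨i, hi⟩
    exact ⟨i, ih i A B P hP x y hxy hi⟩
  | Ebar_conj _ ih =>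
    exact fun A _ B _ P hP x y hxy hx i => ih i A B P hP x y hxy (hx i)
  | Abar_base _ ih =>
    intro A _ B _ P hP x y hxy hx
    by_contra hy
    obtain ⟨γ, hγ, D, hD, h'⟩ := ih B y hy
    obtain ⟨Q, hPQ, hDQ, hQ⟩ := (BackForth.true_iff.1 hP).2 γ hγ D hD
    exact h' A Q hDQ hQ x (fun i => hPQ (hxy i)) hx
  | Abar_disj _ ih =>
    rintro A _ B _ P hP x y hxy ⟨i, hi⟩
    exact ⟨i, ih i A B P hP x y hxy hi⟩
  | Abar_conj _ ih =>
    exact fun A _ B _ P hP x y hxy hx i => ih i A B P hP x y hxy (hx i)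

end InfFormula

-- Countable index sets and tuples as relations.

universe w

theorem Ordinal.countable_Iio_of_lt_omega_one {β : Ordinal.{0}} (hβ : β < Ordinal.omega 1) :
    Countable (Set.Iio β) := by
  rw [Set.countable_coe_iff, ← Cardinal.le_aleph0_iff_set_countable, Cardinal.mk_Iio_ordinal,
    Cardinal.lift_le_aleph0, ← Cardinal.lt_aleph_one_iff]
  exact Cardinal.lt_omega_iff_card_lt.1 hβ

/-- Formulas are indexed by types in `Type`, whereas tuples from `A` live in `Type u`. -/
instance Shrink.countable {ι : Type w} [Countable ι] : Countable (Shrink.{0} ι) :=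
  Countable.of_equiv _ (equivShrink.{0} ι)

theorem Set.Finite.exists_eq_range_fin {M : Type u} {D : Set M} (hD : D.Finite) :
    ∃ (k : ℕ) (x : Fin k → M), D = Set.range x := by
  have := hD.fintype
  refine ⟨Fintype.card D, fun i => (Fintype.equivFin D).symm i, ?_⟩
  ext z
  refine ⟨fun hz => ⟨Fintype.equivFin D ⟨z, hz⟩, by simp⟩, ?_⟩
  rintro ⟨i, rfl⟩
  exact ((Fintype.equivFin D).symm i).2

/-- The relation between two structures given by a pair of tuples. -/
def tupleGraph {A : Type u} {B : Type v} {n : ℕ} (c : Fin n → A) (d : Fin n → B) : Set (A × B) :=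
  Set.range fun i => (c i, d i)

section tupleGraph

variable {A : Type u} {B : Type v} {n k : ℕ} (c : Fin n → A) (d : Fin n → B) (c' : Fin k → A)
  (d' : Fin k → B)

theorem tupleGraph_subset_append :
    tupleGraph c d ⊆ tupleGraph (Fin.append c c') (Fin.append d d') := by
  rintro _ ⟨i, rfl⟩
  exact ⟨Fin.castAdd k i, by simp⟩

theorem range_subset_fst_append :
    Set.range c' ⊆ Prod.fst '' tupleGraph (Fin.append c c') (Fin.append d d') := by
  rintro _ ⟨i, rfl⟩
  exact ⟨_, ⟨Fin.natAdd n i, rfl⟩, by simp⟩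

theorem range_subset_snd_append :
    Set.range d' ⊆ Prod.snd '' tupleGraph (Fin.append c c') (Fin.append d d') := by
  rintro _ ⟨i, rfl⟩
  exact ⟨_, ⟨Fin.natAdd n i, rfl⟩, by simp⟩

end tupleGraph

/-! ### Formulas describing back-and-forth types. -/

namespace InfFormula

section Basic

variable {L : FirstOrder.Language.{0, 0}} {M : Type u} [L.Structure M]

/-- Conjunction over a countable index type of any universe. -/
noncomputable def countableConj {n : ℕ} (ι : Type w) [Countable ι] (φ : ι → InfFormula L n) :
    InfFormula L n :=
  conj (Shrink.{0} ι) inferInstance fun i => φ ((equivShrink.{0} ι).symm i)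

/-- Disjunction over a countable index type of any universe. -/
noncomputable def countableDisj {n : ℕ} (ι : Type w) [Countable ι] (φ : ι → InfFormula L n) :
    InfFormula L n :=
  disj (Shrink.{0} ι) inferInstance fun i => φ ((equivShrink.{0} ι).symm i)

theorem realize_countableConj {n : ℕ} {ι : Type w} [Countable ι] {φ : ι → InfFormula L n}
    {x : Fin n → M} : (countableConj ι φ).Realize x ↔ ∀ i, (φ i).Realize x :=
  (equivShrink.{0} ι).symm.forall_congr fun {_} => Iff.rfl

theorem realize_countableDisj {n : ℕ} {ι : Type w} [Countable ι] {φ : ι → InfFormula L n}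
    {x : Fin n → M} : (countableDisj ι φ).Realize x ↔ ∃ i, (φ i).Realize x :=
  (equivShrink.{0} ι).symm.exists_congr fun {_} => Iff.rfl

theorem realize_exs {n : ℕ} {x : Fin n → M} : ∀ (k : ℕ) {φ : InfFormula L (n + k)},
    (exs k φ).Realize x ↔ ∃ y : Fin k → M, φ.Realize (Fin.append x y)
  | 0, φ => by
    have h (y : Fin 0 → M) : Fin.append x y = x := by
      rw [Subsingleton.elim y Fin.elim0, Fin.append_elim0]; rfl
    simp [exs, h]
  | k + 1, φ => by
    refine (realize_exs k).trans ⟨?_, ?_⟩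
    · rintro ⟨y, z, h⟩
      exact ⟨Fin.snoc y z, by rw [Fin.append_snoc]; exact h⟩
    · rintro ⟨y, h⟩
      refine ⟨Fin.init y, y (Fin.last k), ?_⟩
      rwa [← Fin.snoc_init_self y, Fin.append_snoc] at h

theorem realize_alls {n : ℕ} {x : Fin n → M} : ∀ (k : ℕ) {φ : InfFormula L (n + k)},
    (alls k φ).Realize x ↔ ∀ y : Fin k → M, φ.Realize (Fin.append x y)
  | 0, φ => by
    have h (y : Fin 0 → M) : Fin.append x y = x := by
      rw [Subsingleton.elim y Fin.elim0, Fin.append_elim0]; rfl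
    simp [alls, h]
  | k + 1, φ => by
    refine (realize_alls k).trans ⟨?_, ?_⟩
    · intro h y
      rw [← Fin.snoc_init_self y, Fin.append_snoc]
      exact h _ _
    · intro h y z
      have := h (Fin.snoc y z)
      rwa [Fin.append_snoc] at this

theorem InClass.exs {α : Ordinal.{0}} (hα : 1 < α) {n : ℕ} : ∀ (k : ℕ) {φ : InfFormula L (n + k)},
    InClass .E α φ → InClass .E α (exs k φ)
  | 0, _, h => h
  | k + 1, _, h => InClass.exs hα k (.E_ex hα h)

theorem InClass.alls {α : Ordinal.{0}} (hα : 1 < α) {n : ℕ} : ∀ (k : ℕ) {φ : InfFormula L (n + k)},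
    InClass .A α φ → InClass .A α (alls k φ)
  | 0, _, h => h
  | k + 1, _, h => InClass.alls hα k (.A_all hα h)

end Basic

open Classical in
/-- The formula saying that `x_i ≤ x_j` holds exactly if `r i j`. -/
noncomputable def orderType {n : ℕ} (r : Fin n → Fin n → Prop) : InfFormula Language.order n :=
  conj (Fin n × Fin n) inferInstance fun p =>
    if r p.1 p.2 then rel Language.orderRel.le ![.var p.1, .var p.2]
    else neg (rel Language.orderRel.le ![.var p.1, .var p.2])

theorem isFinitaryQF_orderType {n : ℕ} (r : Fin n → Fin n → Prop) :
    IsFinitaryQF (orderType r) := by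
  refine .conj inferInstance fun p => ?_
  split_ifs
  · exact .rel _ _
  · exact .neg (.rel _ _)

theorem realize_orderType {n : ℕ} {r : Fin n → Fin n → Prop} {M : Type u} [LinearOrder M]
    {x : Fin n → M} : (orderType r).Realize x ↔ ∀ i j, x i ≤ x j ↔ r i j := by
  have h (i j : Fin n) : (rel (L := Language.order) Language.orderRel.le
      ![.var i, .var j]).Realize x ↔ x i ≤ x j := Iff.rfl
  refine (Prod.forall (p := fun p : Fin n × Fin n => _)).trans ?_
  refine forall₂_congr fun i j => ?_
  by_cases hr : r i j
  · simp only [hr, if_true, h, iff_true]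
  · simp only [hr, if_false, iff_false, Realize]
    exact not_congr (h i j)

theorem isPartialIso_tupleGraph_iff {A : Type u} {B : Type v} [LinearOrder A] [LinearOrder B]
    {n : ℕ} {c : Fin n → A} {d : Fin n → B} :
    IsPartialIso (tupleGraph c d) ↔ ∀ i j, c i ≤ c j ↔ d i ≤ d j := by
  simp [IsPartialIso, tupleGraph]

variable {A : Type u} [LinearOrder A] {n : ℕ}

/-- `φ` is true of `c` and implies the back-and-forth relation with `(A, c)`. -/
def Captures (β : Ordinal.{0}) (dir : Bool) (c : Fin n → A) (φ : InfFormula Language.order n) :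
    Prop :=
  φ.Realize c ∧ ∀ (B : Type v) [LinearOrder B] (d : Fin n → B), φ.Realize d →
    BackForth β dir (tupleGraph c d)

/-- `E_α` formulas describing one existential step. -/
theorem exists_E_extension {α γ : Ordinal.{0}} (hα : 1 ≤ α) (hγ : γ < α)
    (ih : ∀ δ, 1 ≤ δ → δ < α → ∀ {m : ℕ} (e : Fin m → A),
      ∃ φ, InClass .A δ φ ∧ Captures.{u, v} δ true e φ) (c : Fin n → A) {k : ℕ} (c' : Fin k → A) :
    ∃ φ : InfFormula Language.order n, InClass .E α φ ∧ φ.Realize c ∧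
      ∀ (B : Type v) [LinearOrder B] (d : Fin n → B), φ.Realize d → ∃ d' : Fin k → B,
        BackForth γ true (tupleGraph (Fin.append c c') (Fin.append d d')) := by
  obtain rfl | hα := hα.eq_or_lt
  · obtain rfl := Order.lt_one_iff.1 hγ
    refine ⟨disj (n := n) Unit inferInstance fun _ => exs k
      (orderType fun i j => Fin.append c c' i ≤ Fin.append c c' j),
      .E_one ⟨_, _, _, _, fun _ => isFinitaryQF_orderType _, rfl⟩,
      ⟨(), (realize_exs k).2 ⟨c', realize_orderType.2 fun _ _ => Iff.rfl⟩⟩, ?_⟩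
    rintro B _ d ⟨_, hd⟩
    obtain ⟨d', hd'⟩ := (realize_exs k).1 hd
    exact ⟨d', BackForth.zero_iff.2 <| isPartialIso_tupleGraph_iff.2 fun i j =>
      (realize_orderType.1 hd' i j).symm⟩
  -- The classes start at level 1, so γ = 0 is treated through level 1.
  · obtain ⟨φ, hφ, hc, h⟩ := ih (max γ 1) (le_max_right _ _) (max_lt hγ hα) (Fin.append c c')
    refine ⟨exs k φ, .exs hα k (.E_base (le_max_right _ _) (max_lt hγ hα) (.Abar_base hφ)),
      (realize_exs k).2 ⟨c', hc⟩, fun B _ d hd => ?_⟩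
    obtain ⟨d', hd'⟩ := (realize_exs k).1 hd
    exact ⟨d', (h B _ hd').mono subset_rfl (le_max_left _ _)⟩

/-- One conjunct for each γ < β and each finite tuple of `A`, asserting that the tuple has a
γ-counterpart. There are countably many, and conjoining them is what forces Ē_β instead of E_β. -/
theorem exists_Ebar_captures [Countable A] {β : Ordinal.{0}} (hβ : 1 ≤ β)
    (hβ' : β < Ordinal.omega 1)
    (ih : ∀ δ, 1 ≤ δ → δ < β → ∀ {m : ℕ} (e : Fin m → A),
      ∃ φ, InClass .A δ φ ∧ Captures.{u, v} δ true e φ) (c : Fin n → A) :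
    ∃ φ, InClass .Ebar β φ ∧ Captures.{u, v} β false c φ := by
  have := Ordinal.countable_Iio_of_lt_omega_one hβ'
  choose φ hφ hc h using fun i : Set.Iio β × Σ k, (Fin k → A) =>
    exists_E_extension hβ i.1.2 ih c i.2.2
  refine ⟨countableConj _ φ, .Ebar_conj fun i => .Ebar_base (hφ _), realize_countableConj.2 hc,
    fun B _ d hd => BackForth.false_of_forall_ge (zero_lt_one.trans_le hβ) ?_⟩
  intro γ _ hγ D hD
  obtain ⟨k, c', rfl⟩ := hD.exists_eq_range_fin
  obtain ⟨d', hd'⟩ := h (⟨γ, hγ⟩, ⟨k, c'⟩) B d (realize_countableConj.1 hd _)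
  exact ⟨_, tupleGraph_subset_append c d c' d', range_subset_fst_append c d c' d', hd'⟩

/-- Every k-tuple must extend the given one in an order type realized in `A`. For fixed k there are
only finitely many order types, so the matrix is finitary. -/
theorem exists_A_one_captures (c : Fin n → A) :
    ∃ φ, InClass .A 1 φ ∧ Captures.{u, v} 1 true c φ := by
  refine ⟨conj ℕ inferInstance fun k => alls k (disj {r : Fin (n + k) → Fin (n + k) → Prop //
      ∃ c' : Fin k → A, ∀ i j, r i j ↔ Fin.append c c' i ≤ Fin.append c c' j} inferInstance
      fun r => orderType r.1),
    .A_one ⟨_, _, _, _, fun k => .disj inferInstance fun r => isFinitaryQF_orderType _, rfl⟩,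
    fun k => (realize_alls k).2 fun c' =>
      ⟨⟨_, c', fun _ _ => Iff.rfl⟩, realize_orderType.2 fun _ _ => Iff.rfl⟩,
    fun B _ d hd => BackForth.true_of_forall_ge zero_lt_one ?_⟩
  intro γ _ hγ D hD
  obtain rfl := Order.lt_one_iff.1 hγ
  obtain ⟨k, d', rfl⟩ := hD.exists_eq_range_fin
  obtain ⟨⟨r, c', hr⟩, h⟩ := (realize_alls k).1 (hd k) d'
  refine ⟨_, tupleGraph_subset_append c d c' d', range_subset_snd_append c d c' d', ?_⟩
  exact BackForth.zero_iff.2 <| isPartialIso_tupleGraph_iff.2 fun i j =>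
    (hr i j).symm.trans (realize_orderType.1 h i j).symm

/-- Every tuple of a countable linear order has an `A_β` formula describing its `β`-th asymmetric
back-and-forth type. -/
theorem exists_A_captures [Countable A] {β : Ordinal.{0}} (hβ : 1 ≤ β) (hβ' : β < Ordinal.omega 1)
    (c : Fin n → A) : ∃ φ, InClass .A β φ ∧ Captures.{u, v} β true c φ := by
  induction β using WellFoundedLT.induction generalizing n with
  | ind β ih =>
  obtain rfl | hβ₁ := hβ.eq_or_lt
  · exact exists_A_one_captures c
  have := Ordinal.countable_Iio_of_lt_omega_one hβ'
  have : Countable (Set.Ico 1 β) := ((Set.to_countable (Set.Iio β)).mono fun _ h => h.2).to_subtype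
  choose φ hφ hc h using fun (γ : Set.Ico 1 β) (k : ℕ) (c' : Fin k → A) =>
    exists_Ebar_captures.{u, v} γ.2.1 (γ.2.2.trans hβ')
      (fun δ hδ hδγ m e => ih δ (hδγ.trans γ.2.2) hδ ((hδγ.trans γ.2.2).trans hβ') e)
      (Fin.append c c')
  -- For all γ in [1, β) and all k: every k-tuple has the γ-type of some k-tuple of `A`. The
  -- disjunction over tuples of `A` stays in Ē_γ.
  refine ⟨countableConj (Set.Ico 1 β × ℕ) fun i => alls i.2 (countableDisj _ (φ i.1 i.2)),
    .A_conj hβ₁ fun i => .alls hβ₁ _ (.A_base ((equivShrink.{0} _).symm i).1.2.1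
      ((equivShrink.{0} _).symm i).1.2.2 (.Ebar_disj fun _ => hφ _ _ _)),
    realize_countableConj.2 fun i => (realize_alls _).2 fun c' =>
      realize_countableDisj.2 ⟨c', hc _ _ _⟩,
    fun B _ d hd => BackForth.true_of_forall_ge hβ₁ ?_⟩
  intro γ hγ₁ hγ D hD
  obtain ⟨k, d', rfl⟩ := hD.exists_eq_range_fin
  obtain ⟨c', h'⟩ := realize_countableDisj.1
    ((realize_alls k).1 (realize_countableConj.1 hd (⟨γ, hγ₁, hγ⟩, k)) d')
  exact ⟨_, tupleGraph_subset_append c d c' d', range_subset_snd_append c d c' d',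
    h ⟨γ, hγ₁, hγ⟩ k c' B _ h'⟩

/-- An `E_α` sentence true in a countable linear order `A` can say that a finite subset of `A` has
a `γ`-counterpart, for `γ < α`. -/
theorem exists_E_sentence [Countable A] {α γ : Ordinal.{0}} (hα : 1 ≤ α)
    (hα' : α < Ordinal.omega 1) (hγ : γ < α) {D : Set A} (hD : D.Finite) :
    ∃ θ : InfSentence Language.order, IsE α θ ∧ θ.Holds A ∧
      ∀ (B : Type v) [LinearOrder B], θ.Holds B → ∃ P : Set (A × B),
        D ⊆ Prod.fst '' P ∧ BackForth γ true P := by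
  obtain ⟨k, c', rfl⟩ := hD.exists_eq_range_fin
  obtain ⟨φ, hφ, hc, h⟩ := exists_E_extension.{u, v} hα hγ
    (fun δ hδ hδα m e => exists_A_captures hδ (hδα.trans hα') e) (Fin.elim0 : Fin 0 → A) c'
  refine ⟨φ, hφ, hc, fun B _ hB => ?_⟩
  obtain ⟨d', hd'⟩ := h B _ hB
  exact ⟨_, range_subset_fst_append _ _ c' d', hd'⟩

end InfFormula

/-! ### Position of points relative to the cut intervals. -/

section cutInterval

variable {M : Type u} [LinearOrder M] {n : ℕ} {a : Fin n → M} {k l : Fin (n + 1)} {x y : M}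

theorem lt_of_mem_cutInterval (ha : StrictMono a) (hx : x ∈ cutInterval a k) {i : Fin n}
    (hi : (i : ℕ) < k) : a i < x := by
  have hk := k.2
  refine (ha.monotone (b := ⟨k - 1, by lia⟩) (Fin.le_def.2 ?_)).trans_lt (hx.1 _ ?_)
  · simp only; lia
  · simp only; lia

theorem mem_cutInterval_lt (ha : StrictMono a) (hx : x ∈ cutInterval a k) {i : Fin n}
    (hi : (k : ℕ) ≤ i) : x < a i :=
  (hx.2 ⟨k, hi.trans_lt i.2⟩ rfl).trans_le (ha.monotone (Fin.le_def.2 hi))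

theorem le_iff_of_mem_cutInterval (ha : StrictMono a) (hx : x ∈ cutInterval a k) {i : Fin n} :
    a i ≤ x ↔ (i : ℕ) < k :=
  ⟨fun h => not_le.1 fun hi => h.not_gt (mem_cutInterval_lt ha hx hi),
    fun h => (lt_of_mem_cutInterval ha hx h).le⟩

theorem mem_cutInterval_le_iff (ha : StrictMono a) (hx : x ∈ cutInterval a k) {i : Fin n} :
    x ≤ a i ↔ (k : ℕ) ≤ i :=
  ⟨fun h => not_lt.1 fun hi => h.not_gt (lt_of_mem_cutInterval ha hx hi),
    fun h => (mem_cutInterval_lt ha hx h).le⟩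

theorem lt_of_mem_cutInterval_of_lt (ha : StrictMono a) (hx : x ∈ cutInterval a k)
    (hy : y ∈ cutInterval a l) (hkl : k < l) : x < y := by
  have hl := l.2
  have hkl : (k : ℕ) < l := hkl
  exact (hx.2 ⟨k, by lia⟩ rfl).trans (lt_of_mem_cutInterval ha hy hkl)

theorem exists_eq_or_exists_mem_cutInterval (a : Fin n → M) (x : M) :
    (∃ i, a i = x) ∨ ∃ k, x ∈ cutInterval a k := by
  by_cases h : ∃ i, x ≤ a i
  -- The least such i either names x or is the upper end of its interval.
  · obtain ⟨i, hi, hmin⟩ := WellFounded.has_min (wellFounded_lt (α := Fin n)) {i | x ≤ a i} h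
    rcases hi.eq_or_lt with hi | hi
    · exact .inl ⟨i, hi.symm⟩
    · refine .inr ⟨i.castSucc, fun j hj => not_le.1 fun hj' => hmin j hj' ?_, fun j hj => ?_⟩
      · simp only [Fin.val_castSucc] at hj
        exact Fin.lt_def.2 (by lia)
      · obtain rfl : j = i := Fin.ext hj
        exact hi
  · push Not at h
    exact .inr ⟨Fin.last n, fun i _ => h i, fun i hi => absurd hi i.2.ne⟩

end cutInterval

/-! ### Gluing relations along intervals. -/

variable {A : Type u} {B : Type v} [LinearOrder A] [LinearOrder B] {n : ℕ}

/-- The union of relations between corresponding intervals, together with the pairs of end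
points. -/
def glue (a : Fin n → A) (b : Fin n → B)
    (P : ∀ k, Set (cutInterval a k × cutInterval b k)) : Set (A × B) :=
  tupleGraph a b ∪ ⋃ k, Prod.map Subtype.val Subtype.val '' P k

section glue

variable {a : Fin n → A} {b : Fin n → B} {P Q : ∀ k, Set (cutInterval a k × cutInterval b k)}

theorem glue_mono (h : ∀ k, P k ⊆ Q k) : glue a b P ⊆ glue a b Q :=
  Set.union_subset_union_right _ (Set.iUnion_mono fun k => Set.image_mono (h k))

theorem mem_glue_left (i : Fin n) : (a i, b i) ∈ glue a b P :=
  .inl ⟨i, rfl⟩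

theorem mem_glue_right {k : Fin (n + 1)} {p : cutInterval a k × cutInterval b k} (hp : p ∈ P k) :
    ((p.1 : A), (p.2 : B)) ∈ glue a b P :=
  .inr (Set.mem_iUnion.2 ⟨k, p, hp, rfl⟩)

theorem subset_fst_glue {D : Set A} (h : ∀ k, Subtype.val ⁻¹' D ⊆ Prod.fst '' P k) :
    D ⊆ Prod.fst '' glue a b P := by
  intro x hx
  obtain ⟨i, rfl⟩ | ⟨k, hk⟩ := exists_eq_or_exists_mem_cutInterval a x
  · exact ⟨_, mem_glue_left i, rfl⟩
  · obtain ⟨p, hp, hpx⟩ := @h k ⟨x, hk⟩ hx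
    exact ⟨_, mem_glue_right hp, congrArg Subtype.val hpx⟩

theorem subset_snd_glue {D : Set B} (h : ∀ k, Subtype.val ⁻¹' D ⊆ Prod.snd '' P k) :
    D ⊆ Prod.snd '' glue a b P := by
  intro x hx
  obtain ⟨i, rfl⟩ | ⟨k, hk⟩ := exists_eq_or_exists_mem_cutInterval b x
  · exact ⟨_, mem_glue_left i, rfl⟩
  · obtain ⟨p, hp, hpx⟩ := @h k ⟨x, hk⟩ hx
    exact ⟨_, mem_glue_right hp, congrArg Subtype.val hpx⟩

theorem isPartialIso_glue (ha : StrictMono a) (hb : StrictMono b)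
    (h : ∀ k, IsPartialIso (P k)) : IsPartialIso (glue a b P) := by
  rintro _ (⟨i, rfl⟩ | hp) _ (⟨j, rfl⟩ | hq)
  · exact ha.le_iff_le.trans hb.le_iff_le.symm
  · obtain ⟨k, q, hq, rfl⟩ := Set.mem_iUnion.1 hq
    exact (le_iff_of_mem_cutInterval ha q.1.2).trans (le_iff_of_mem_cutInterval hb q.2.2).symm
  · obtain ⟨k, p, hp, rfl⟩ := Set.mem_iUnion.1 hp
    exact (mem_cutInterval_le_iff ha p.1.2).trans (mem_cutInterval_le_iff hb p.2.2).symm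
  · obtain ⟨k, p, hp', rfl⟩ := Set.mem_iUnion.1 hp
    obtain ⟨l, q, hq', rfl⟩ := Set.mem_iUnion.1 hq
    rcases lt_trichotomy k l with hkl | rfl | hkl
    · exact iff_of_true (lt_of_mem_cutInterval_of_lt ha p.1.2 q.1.2 hkl).le
        (lt_of_mem_cutInterval_of_lt hb p.2.2 q.2.2 hkl).le
    · exact h k p hp' q hq'
    · exact iff_of_false (lt_of_mem_cutInterval_of_lt ha q.1.2 p.1.2 hkl).not_ge
        (lt_of_mem_cutInterval_of_lt hb q.2.2 p.2.2 hkl).not_ge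

/-- A finite challenge splits into its traces on the intervals, answered separately at the same γ,
and end points, which are already matched. -/
theorem BackForth.glue (ha : StrictMono a) (hb : StrictMono b) {β : Ordinal.{0}} {dir : Bool}
    (h : ∀ k, BackForth β dir (P k)) : BackForth β dir (glue a b P) := by
  induction β using WellFoundedLT.induction generalizing dir P with
  | ind β ih =>
  have hiso := isPartialIso_glue ha hb fun k => (h k).isPartialIso
  cases dir
  · refine BackForth.false_iff.2 ⟨hiso, fun γ hγ D hD => ?_⟩
    choose Q hPQ hDQ hQ using fun k => (BackForth.false_iff.1 (h k)).2 γ hγ _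
      (hD.preimage Subtype.val_injective.injOn)
    exact ⟨_, glue_mono hPQ, subset_fst_glue hDQ, ih γ hγ hQ⟩
  · refine BackForth.true_iff.2 ⟨hiso, fun γ hγ D hD => ?_⟩
    choose Q hPQ hDQ hQ using fun k => (BackForth.true_iff.1 (h k)).2 γ hγ _
      (hD.preimage Subtype.val_injective.injOn)
    exact ⟨_, glue_mono hPQ, subset_snd_glue hDQ, ih γ hγ hQ⟩

end glue

theorem mainTheorem9 {𝓛 : Type u} [LinearOrder 𝓛] [Countable 𝓛]
    {α : Ordinal.{0}} (hα_one : 1 ≤ α) (hα : α < Ordinal.omega 1)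
    {n : ℕ} (a : Fin n → 𝓛) (ha : StrictMono a)
    (φ : InfFormula FirstOrder.Language.order n) (hφ : φ.IsE α) (hφa : φ.Realize a) :
    ∃ θ : Fin (n + 1) → InfSentence FirstOrder.Language.order,
      (∀ k, InfFormula.IsE α (θ k)) ∧
      (∀ k, (θ k).Holds (cutInterval a k)) ∧
      (∀ (B : Type v) [LinearOrder B] (b : Fin n → B), StrictMono b →
        (∀ k, (θ k).Holds (cutInterval b k)) → φ.Realize b) := by
  -- γ and D are fixed before `B` appears, so the θ_k can be chosen independently of `B`.
  obtain ⟨γ, hγ, D, hD, h⟩ := InfFormula.InClass.preserved.{u, v} hφ 𝓛 a hφa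
  choose θ hθ hθa hθP using fun k => InfFormula.exists_E_sentence.{u, v}
    (A := cutInterval a k) hα_one hα hγ (hD.preimage Subtype.val_injective.injOn)
  refine ⟨θ, hθ, hθa, fun B _ b hb hθb => ?_⟩
  choose P hDP hP using fun k => hθP k (cutInterval b k) (hθb k)
  exact h B _ (subset_fst_glue hDP) (.glue ha hb hP) b mem_glue_left
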